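/- Let $p\ge 5$ be a prime and $\mathbb F$ a field of characteristic $p$. For positive integers $i,j$ let $a_{i,j}\in\{-1,0,1\}$ be the representative of $j-i$ modulo $3$, and let $\mathfrak n=n_+(A_1^{(1)})=\bigoplus_{i\ge 1}\mathbb F e_i$ be the Lie algebra over $\mathbb F$ with bracket $[e_i,e_j]=a_{i,j}e_{i+j}$. Let $\mathfrak g(p)=\mathfrak n/(e_{p+1})$ be its quotient by the ideal generated by $e_{p+1}$; it has basis $e_1,\dots,e_p$. Consider the cochain spaces $C^q=(\wedge^q\mathfrak g(p))^*$ with dual bases $e^k$ ($1\le k\le p$) of $C^1$ and $e^{i,j}$ ($1\le i<j\le p$) of $C^2$, and the differentials \[d^1(\psi)(g\wedge h)=\psi([g,h]),\qquad d^2(\varphi)(g\wedge h\wedge f)=\varphi([g,h]\wedge f)-\varphi([g,f]\wedge h)+\varphi([h,f]\wedge g).\] Let $C^1_k$ be the span of $e^k$ if $1\le k\le p$ and $0$ otherwise, let $C^2_k=\operatorname{span}\{e^{i,j} : 1\le i<j\le p,\ i+j=k\}$, let $d^q_k$ be the restriction of $d^q$ to $C^q_k$, and let $H^2_k=\ker d^2_k/\operatorname{im}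 d^1_k$. For $3\le k\le 2p-1$ put \[\varphi_k=\sum_{i=M(p,k)}^{s(k)}a_{i,k-i}\,e^{i,k-i},\] where $s(k)=\frac k2-1$ for $k$ even, $s(k)=\frac{k-1}2$ for $k$ odd, $M(p,k)=1$ for $k\le p+1$ and $M(p,k)=k-p$ for $k\ge p+2$. Then: 1. If $k\ge p+2$ and $(p,k)\ne(5,7)$, then $\ker d^2_k=0$. 2. If $3\le k<p+2$ and $k\ne 5,7$, then $\{\varphi_k\}$ is a basis of $\ker d^2_k$. 3. $\{e^{1,4},\varphi_5\}$ is a basis of $\ker d^2_5$. 4. A basis of $\ker d^2_7$ is $\{e^{2,5}\}$ if $p=5$, and $\{e^{2,5},\varphi_7\}$ if $p>5$. 5. $\varphi_k=d^1(e^k)$ for $3\le k\le p$. 6. $H^2_k=0$ for all $k\notin\{5,7,p+1\}$, and the spaces $H^2_5$, $H^2_7$, $H^2_{p+1}$ are one-dimensional, with bases given by the classes of $e^{1,4}$, $e^{2,5}$ and $\varphi_{p+1}$, respectively. -/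

import Mathlib

namespace AffineNilp

/-- The structure constant `a_{i,j} ∈ {-1, 0, 1}`, the representative of `j - i` modulo `3`,
viewed in the field `F`. -/
def a (F : Type*) [Field F] (i j : ℕ) : F :=
  if ((j : ℤ) - (i : ℤ)) % 3 = 1 then 1
  else if ((j : ℤ) - (i : ℤ)) % 3 = 2 then -1
  else 0

theorem a_swap (F : Type*) [Field F] (i j : ℕ) : a F j i = - a F i j := by
  unfold a
  split_ifs <;> first | omega | simp

theorem a_self (F : Type*) [Field F] (i : ℕ) : a F i i = 0 := by
  simp [a]

theorem a_mod (F : Type*) [Field F] (i j : ℕ) : a F i j = a F (i % 3) (j % 3) := by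
  have h : ((j : ℤ) - (i : ℤ)) % 3 = (((j % 3 : ℕ) : ℤ) - ((i % 3 : ℕ) : ℤ)) % 3 := by omega
  simp only [a, h]

theorem a_jacobi (F : Type*) [Field F] (i j k : ℕ) :
    a F j k * a F i (j + k) = a F i j * a F (i + j) k + a F i k * a F j (i + k) := by
  rw [a_mod F j k, a_mod F i (j + k), a_mod F i j, a_mod F (i + j) k, a_mod F i k,
    a_mod F j (i + k), Nat.add_mod j k, Nat.add_mod i j, Nat.add_mod i k]
  have hi := Nat.mod_lt i (show 0 < 3 by norm_num)
  have hj := Nat.mod_lt j (show 0 < 3 by norm_num)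
  have hk := Nat.mod_lt k (show 0 < 3 by norm_num)
  generalize i % 3 = r at *
  generalize j % 3 = s at *
  generalize k % 3 = t at *
  interval_cases r <;> interval_cases s <;> interval_cases t <;> norm_num [a]

/-! ### The Lie algebra `n_+(A_1^{(1)})` -/

/-- The underlying vector space of `n_+(A_1^{(1)})`, with basis indexed by the positive integers. -/
def NPlus (F : Type*) [Field F] : Type _ := ℕ+ →₀ F

namespace NPlus

noncomputable instance (F : Type*) [Field F] : AddCommGroup (NPlus F) :=
  inferInstanceAs (AddCommGroup (ℕ+ →₀ F))

noncomputable instance (F : Type*) [Field F] : Module F (NPlus F) :=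
  inferInstanceAs (Module F (ℕ+ →₀ F))

/-- The basis `e_1, e_2, …` of `n_+(A_1^{(1)})`. -/
noncomputable def basis (F : Type*) [Field F] : Module.Basis ℕ+ F (NPlus F) :=
  ⟨LinearEquiv.refl F (ℕ+ →₀ F)⟩

/-- The bilinear map with `(e_i, e_j) ↦ a_{i,j} e_{i+j}`. -/
noncomputable def bracketMap (F : Type*) [Field F] : NPlus F →ₗ[F] NPlus F →ₗ[F] NPlus F :=
  (basis F).constr F fun i => (basis F).constr F fun j => a F i j • basis F (i + j)

theorem bracketMap_basis (F : Type*) [Field F] (i j : ℕ+) :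
    bracketMap F (basis F i) (basis F j) = a F i j • basis F (i + j) := by
  simp [bracketMap]

theorem bracketMap_swap (F : Type*) [Field F] (x y : NPlus F) :
    bracketMap F x y = - bracketMap F y x := by
  have h : bracketMap F = - (bracketMap F).flip := by
    refine (basis F).ext fun i => (basis F).ext fun j => ?_
    simp [bracketMap_basis, a_swap F i j, add_comm i j]
  exact congrArg (fun f => f x y) h

theorem bracketMap_self (F : Type*) [Field F] (x : NPlus F) : bracketMap F x x = 0 := by
  have hb : ∀ (i : ℕ+) (s : F), (Finsupp.single i s : ℕ+ →₀ F) = s • basis F i := by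
    intro i s
    change _ = s • (Finsupp.single i (1 : F) : ℕ+ →₀ F)
    rw [Finsupp.smul_single, smul_eq_mul, mul_one]
  refine Finsupp.induction (motive := fun x : ℕ+ →₀ F => bracketMap F x x = 0) x ?_ ?_
  · exact LinearMap.map_zero _
  · intro i s f _ _ hf
    obtain ⟨g, rfl⟩ : ∃ g : NPlus F, g = f := ⟨f, rfl⟩
    rw [hb]
    change bracketMap F (s • basis F i + g) (s • basis F i + g) = 0
    replace hf : bracketMap F g g = 0 := hf
    simp only [map_add, LinearMap.add_apply, hf, bracketMap_swap F g (s • basis F i)]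
    simp [bracketMap_basis, a_self]

theorem bracketMap_jacobi (F : Type*) [Field F] (x y z : NPlus F) :
    bracketMap F x (bracketMap F y z) =
      bracketMap F (bracketMap F x y) z + bracketMap F y (bracketMap F x z) := by
  have hspan : ∀ u : NPlus F, u ∈ Submodule.span F (Set.range (basis F)) := by simp
  induction hspan x using Submodule.span_induction with
  | zero => simp
  | add u v _ _ hu hv => simp only [map_add, LinearMap.add_apply, hu, hv]; abel
  | smul t u _ hu => simp only [map_smul, LinearMap.smul_apply, hu, smul_add]
  | mem x hx =>
    obtain ⟨i, rfl⟩ := hx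
    induction hspan y using Submodule.span_induction with
    | zero => simp
    | add u v _ _ hu hv => simp only [map_add, LinearMap.add_apply, hu, hv]; abel
    | smul t u _ hu => simp only [map_smul, LinearMap.smul_apply, hu, smul_add]
    | mem y hy =>
      obtain ⟨j, rfl⟩ := hy
      induction hspan z using Submodule.span_induction with
      | zero => simp
      | add u v _ _ hu hv => simp only [map_add, hu, hv]; abel
      | smul t u _ hu => simp only [map_smul, hu, smul_add]
      | mem z hz =>
        obtain ⟨k, rfl⟩ := hz
        have h1 : j + (i + k) = i + (j + k) := by rw [← add_assoc, add_comm j i, add_assoc]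
        simp only [bracketMap_basis, map_smul, LinearMap.smul_apply, smul_smul, h1,
          add_assoc i j k, ← add_smul]
        congr 1
        simpa only [PNat.add_coe] using a_jacobi F i j k

/-- The bracket `[e_i, e_j] = a_{i,j} e_{i+j}` makes `n_+(A_1^{(1)})` a Lie algebra. -/
noncomputable instance (F : Type*) [Field F] : LieRing (NPlus F) where
  bracket x y := bracketMap F x y
  add_lie x y z := by simp
  lie_add x y z := by simp
  lie_self := bracketMap_self F
  leibniz_lie := bracketMap_jacobi F

noncomputable instance (F : Type*) [Field F] : LieAlgebra F (NPlus F) where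
  lie_smul t x y := (bracketMap F x).map_smul t y

theorem lie_def (F : Type*) [Field F] (x y : NPlus F) : ⁅x, y⁆ = bracketMap F x y := rfl

theorem lie_basis (F : Type*) [Field F] (i j : ℕ+) :
    ⁅basis F i, basis F j⁆ = a F i j • basis F (i + j) :=
  bracketMap_basis F i j

/-- The Lie ideal of elements that only involve the `e_j` with `j > p`. -/
noncomputable def tail (F : Type*) [Field F] (p : ℕ) : LieIdeal F (NPlus F) where
  __ := Submodule.span F (basis F '' {j | p < (j : ℕ)})
  lie_mem := by
    intro x m hm
    change m ∈ Submodule.span F (basis F '' {j | p < (j : ℕ)}) at hm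
    change ⁅x, m⁆ ∈ Submodule.span F (basis F '' {j | p < (j : ℕ)})
    have hx : x ∈ Submodule.span F (Set.range (basis F)) := by simp
    induction hm using Submodule.span_induction with
    | zero => simp
    | add u v _ _ hu hv => rw [lie_add]; exact add_mem hu hv
    | smul t u _ hu => rw [lie_smul]; exact Submodule.smul_mem _ t hu
    | mem m hm =>
      obtain ⟨j, hj, rfl⟩ := hm
      have hj' : p < (j : ℕ) := hj
      induction hx using Submodule.span_induction with
      | zero => simp
      | add u v _ _ hu hv => rw [add_lie]; exact add_mem hu hv
      | smul t u _ hu => rw [smul_lie]; exact Submodule.smul_mem _ t hu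
      | mem x hx =>
        obtain ⟨i, rfl⟩ := hx
        rw [lie_basis]
        refine Submodule.smul_mem _ _ (Submodule.subset_span ⟨i + j, ?_, rfl⟩)
        simp only [Set.mem_ofPred_eq, PNat.add_coe]
        omega

end NPlus

/-! ### The truncation `g(p) = n_+(A_1^{(1)}) / (e_{p+1})` -/

/-- The Lie ideal of `n_+(A_1^{(1)})` generated by `e_{p+1}`. -/
noncomputable def truncIdeal (F : Type*) [Field F] (p : ℕ) : LieIdeal F (NPlus F) :=
  LieSubmodule.lieSpan F (NPlus F) {NPlus.basis F p.succPNat}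

/-- The truncated Lie algebra `g(p) = n_+(A_1^{(1)}) / (e_{p+1})`. -/
abbrev Trunc (F : Type*) [Field F] (p : ℕ) : Type _ := NPlus F ⧸ truncIdeal F p

theorem truncIdeal_le_tail (F : Type*) [Field F] (p : ℕ) : truncIdeal F p ≤ NPlus.tail F p := by
  refine LieSubmodule.lieSpan_le.2 ?_
  rintro _ rfl
  exact Submodule.subset_span ⟨p.succPNat, by simp, rfl⟩

theorem truncIdeal_le_ker_coord (F : Type*) [Field F] (p : ℕ) (k : ℕ+) (hk : (k : ℕ) ≤ p) :
    (truncIdeal F p).toSubmodule ≤ LinearMap.ker ((NPlus.basis F).coord k) := by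
  refine le_trans (show (truncIdeal F p).toSubmodule ≤
    Submodule.span F (NPlus.basis F '' {j | p < (j : ℕ)}) from truncIdeal_le_tail F p) ?_
  refine Submodule.span_le.2 ?_
  rintro _ ⟨j, hj, rfl⟩
  have hj' : p < (j : ℕ) := hj
  have hne : j ≠ k := by rintro rfl; omega
  simp [hne]

/-- The image in `g(p)` of the basis vector `e_k` of `n_+(A_1^{(1)})`. -/
noncomputable def e (F : Type*) [Field F] (p : ℕ) (k : ℕ+) : Trunc F p :=
  LieSubmodule.Quotient.mk (NPlus.basis F k)

/-- The functional `e^k` on `g(p)`, for `1 ≤ k ≤ p`, dual to the basis `e_1, …, e_p`: it is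
induced by the `k`-th coordinate functional on `n_+(A_1^{(1)})`.  By convention it is `0` for
`k` outside of this range. -/
noncomputable def dual (F : Type*) [Field F] (p k : ℕ) : Module.Dual F (Trunc F p) :=
  if hk : 0 < k ∧ k ≤ p then
    (truncIdeal F p).toSubmodule.liftQ ((NPlus.basis F).coord (k.toPNat hk.1))
      (truncIdeal_le_ker_coord F p (k.toPNat hk.1) hk.2)
  else 0

/-- The functionals `e^1, …, e^p` are dual to the elements `e_1, …, e_p`. -/
theorem dual_e (F : Type*) [Field F] (p k : ℕ) (hk : 0 < k) (hkp : k ≤ p) (j : ℕ+) :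
    dual F p k (e F p j) = if (j : ℕ) = k then 1 else 0 := by
  rw [dual, dif_pos ⟨hk, hkp⟩]
  change (NPlus.basis F).repr (NPlus.basis F j) (k.toPNat hk) = _
  rw [Module.Basis.repr_self, Finsupp.single_apply]
  exact if_congr (by rw [← PNat.coe_inj]; rfl) rfl rfl

/-- The elements `e_k` with `k > p` vanish in `g(p)`, if `3` does not divide `p`. -/
theorem e_eq_zero (F : Type*) [Field F] (p : ℕ) (hp : ¬ 3 ∣ p) (k : ℕ+) (hk : p < (k : ℕ)) :
    e F p k = 0 := by
  suffices h : ∀ n : ℕ, ∀ k : ℕ+, (k : ℕ) = p + 1 + n →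
      NPlus.basis F k ∈ truncIdeal F p from
    (LieSubmodule.Quotient.mk_eq_zero').2 (h (k - (p + 1)) k (by omega))
  intro n
  induction n using Nat.strong_induction_on with
  | _ n ih =>
    intro k hk
    have step : ∀ i j : ℕ+, (i : ℕ) + j = k → p + 1 ≤ (j : ℕ) → a F i j ≠ 0 →
        NPlus.basis F k ∈ truncIdeal F p := by
      intro i j hij hj ha
      have hi := i.pos
      have hmem := ih (j - (p + 1)) (by omega) j (by omega)
      have h2 : ⁅NPlus.basis F i, NPlus.basis F j⁆ ∈ truncIdeal F p :=
        LieSubmodule.lie_mem _ hmem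
      rw [NPlus.lie_basis, show i + j = k from PNat.eq hij] at h2
      have h3 := (truncIdeal F p).smul_mem (a F i j)⁻¹ h2
      rwa [smul_smul, inv_mul_cancel₀ ha, one_smul] at h3
    rcases Nat.eq_zero_or_pos n with rfl | hn
    · have : k = p.succPNat := PNat.eq (by simp [hk])
      rw [this]
      exact LieSubmodule.subset_lieSpan rfl
    · by_cases h : (k : ℕ) % 3 = 2
      · refine step 2 ⟨k - 2, by omega⟩ ?_ ?_ ?_
        · simp only [PNat.mk_coe, PNat.val_ofNat]; omega
        · simp only [PNat.mk_coe]; omega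
        · rw [a_mod]
          simp only [PNat.mk_coe, PNat.val_ofNat]
          rw [show ((k : ℕ) - 2) % 3 = 0 by omega]
          norm_num [a]
      · refine step 1 ⟨k - 1, by omega⟩ ?_ ?_ ?_
        · simp only [PNat.mk_coe, PNat.val_ofNat]; omega
        · simp only [PNat.mk_coe]; omega
        · rw [a_mod]
          simp only [PNat.mk_coe, PNat.val_ofNat]
          rcases (show ((k : ℕ) - 1) % 3 = 0 ∨ ((k : ℕ) - 1) % 3 = 2 by omega) with h' | h' <;>
            rw [h'] <;> norm_num [a]

/-! ### Cochains with trivial coefficients -/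

/-- The cochain space `C^q(g(p)) = (⋀^q g(p))^*`, as alternating `q`-linear forms on `g(p)`. -/
abbrev Cochain (F : Type*) [Field F] (p q : ℕ) : Type _ := Trunc F p [⋀^Fin q]→ₗ[F] F

/-- `e^{i,j}`, the dual vector of `e_i ∧ e_j`: the form
`(g, h) ↦ e^i(g) e^j(h) - e^j(g) e^i(h)`. -/
noncomputable def dual₂ (F : Type*) [Field F] (p i j : ℕ) : Cochain F p 2 :=
  Matrix.detRowAlternating.compLinearMap (LinearMap.pi ![dual F p i, dual F p j])

theorem dual₂_apply (F : Type*) [Field F] (p i j : ℕ) (g h : Trunc F p) :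
    dual₂ F p i j ![g, h] = dual F p i g * dual F p j h - dual F p j g * dual F p i h := by
  change Matrix.det (Matrix.of fun x y : Fin 2 => (![dual F p i, dual F p j] y) (![g, h] x)) = _
  rw [Matrix.det_fin_two]
  simp

/-- The differential `d^1`, `d^1(ψ)(g ∧ h) = ψ([g, h])`. -/
noncomputable def d₁ (F : Type*) [Field F] (p : ℕ) :
    Module.Dual F (Trunc F p) →ₗ[F] Cochain F p 2 where
  toFun ψ :=
    { toFun := fun x => ψ ⁅x 0, x 1⁆
      map_update_add' := by
        intro inst x i u v
        rw [Subsingleton.elim inst (instDecidableEqFin 2)]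
        fin_cases i <;> simp
      map_update_smul' := by
        intro inst x i t u
        rw [Subsingleton.elim inst (instDecidableEqFin 2)]
        fin_cases i <;> simp
      map_eq_zero_of_eq' := by
        intro x i j hij hne
        have h : x 0 = x 1 := by
          fin_cases i <;> fin_cases j <;> first | exact absurd rfl hne | exact hij | exact hij.symm
        simp [h] }
  map_add' _ _ := rfl
  map_smul' _ _ := rfl

theorem cochain_add_left {F : Type*} [Field F] {p : ℕ} (φ : Cochain F p 2) (g g' h : Trunc F p) :
    φ ![g + g', h] = φ ![g, h] + φ ![g', h] :=
  φ.toMultilinearMap.cons_add ![h] g g'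

theorem cochain_smul_left {F : Type*} [Field F] {p : ℕ} (φ : Cochain F p 2) (t : F)
    (g h : Trunc F p) : φ ![t • g, h] = t * φ ![g, h] :=
  φ.toMultilinearMap.cons_smul ![h] t g

theorem cochain_self {F : Type*} [Field F] {p : ℕ} (φ : Cochain F p 2) (g : Trunc F p) :
    φ ![g, g] = 0 :=
  φ.map_eq_zero_of_eq ![g, g] (i := 0) (j := 1) rfl (by decide)

theorem cochain_swap {F : Type*} [Field F] {p : ℕ} (φ : Cochain F p 2) (g h : Trunc F p) :
    φ ![g, h] = - φ ![h, g] := by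
  have h1 := φ.map_swap ![h, g] (i := 0) (j := 1) (by decide)
  rw [← h1]
  congr 1
  ext i
  fin_cases i <;> rfl

theorem cochain_add_right {F : Type*} [Field F] {p : ℕ} (φ : Cochain F p 2) (g h h' : Trunc F p) :
    φ ![g, h + h'] = φ ![g, h] + φ ![g, h'] := by
  rw [cochain_swap φ g, cochain_add_left, cochain_swap φ g h, cochain_swap φ g h']
  ring

theorem cochain_smul_right {F : Type*} [Field F] {p : ℕ} (φ : Cochain F p 2) (t : F)
    (g h : Trunc F p) : φ ![g, t • h] = t * φ ![g, h] := by
  rw [cochain_swap φ g, cochain_smul_left, cochain_swap φ g h]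
  ring

/-- The differential `d^2`,
`d^2(φ)(g ∧ h ∧ f) = φ([g, h] ∧ f) - φ([g, f] ∧ h) + φ([h, f] ∧ g)`. -/
noncomputable def d₂ (F : Type*) [Field F] (p : ℕ) : Cochain F p 2 →ₗ[F] Cochain F p 3 where
  toFun φ :=
    { toFun := fun x => φ ![⁅x 0, x 1⁆, x 2] - φ ![⁅x 0, x 2⁆, x 1] + φ ![⁅x 1, x 2⁆, x 0]
      map_update_add' := by
        intro inst x i u v
        have h01 : (0 : Fin 3) ≠ 1 := Fin.ne_of_val_ne (by norm_num)
        have h02 : (0 : Fin 3) ≠ 2 := Fin.ne_of_val_ne (by norm_num)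
        have h12 : (1 : Fin 3) ≠ 2 := Fin.ne_of_val_ne (by norm_num)
        obtain rfl | rfl | rfl : i = 0 ∨ i = 1 ∨ i = 2 := by omega
        all_goals
          simp only [Function.update_self, Function.update_of_ne h01, Function.update_of_ne h02,
            Function.update_of_ne h12, Function.update_of_ne h01.symm,
            Function.update_of_ne h02.symm, Function.update_of_ne h12.symm,
            add_lie, lie_add, cochain_add_left, cochain_add_right]
          ring
      map_update_smul' := by
        intro inst x i t u
        have h01 : (0 : Fin 3) ≠ 1 := Fin.ne_of_val_ne (by norm_num)
        have h02 : (0 : Fin 3) ≠ 2 := Fin.ne_of_val_ne (by norm_num)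
        have h12 : (1 : Fin 3) ≠ 2 := Fin.ne_of_val_ne (by norm_num)
        obtain rfl | rfl | rfl : i = 0 ∨ i = 1 ∨ i = 2 := by omega
        all_goals
          simp only [Function.update_self, Function.update_of_ne h01, Function.update_of_ne h02,
            Function.update_of_ne h12, Function.update_of_ne h01.symm,
            Function.update_of_ne h02.symm, Function.update_of_ne h12.symm,
            smul_lie, lie_smul, smul_eq_mul, cochain_smul_left, cochain_smul_right]
          ring
      map_eq_zero_of_eq' := by
        have h0 : ∀ g : Trunc F p, φ ![0, g] = 0 := fun g => by
          simpa using cochain_smul_left φ 0 0 g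
        have hs : ∀ g h f : Trunc F p, φ ![⁅h, g⁆, f] = - φ ![⁅g, h⁆, f] := fun g h f => by
          rw [← lie_skew, ← neg_one_smul F, cochain_smul_left]
          ring
        intro x i j hij hne
        fin_cases i <;> fin_cases j <;> first | exact absurd rfl hne | skip
        all_goals
          simp only [Fin.zero_eta, Fin.mk_one, Fin.reduceFinMk] at hij
          simp only [hij, lie_self, h0]
          first
            | ring1
            | (rw [hs (x 0) (x 1)]; ring1)
            | (rw [hs (x 1) (x 2)]; ring1) }
  map_add' φ φ' := by
    ext x
    simp
    ring
  map_smul' t φ := by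
    ext x
    simp
    ring

/-- `d^2 ∘ d^1 = 0`. -/
theorem d₂_d₁ (F : Type*) [Field F] (p : ℕ) (ψ : Module.Dual F (Trunc F p)) :
    d₂ F p (d₁ F p ψ) = 0 := by
  ext x
  change ψ ⁅⁅x 0, x 1⁆, x 2⁆ - ψ ⁅⁅x 0, x 2⁆, x 1⁆ + ψ ⁅⁅x 1, x 2⁆, x 0⁆ = 0
  rw [← map_sub, ← map_add]
  convert map_zero ψ
  rw [lie_lie, ← lie_skew (x 1) ⁅x 0, x 2⁆, ← lie_skew (x 0) ⁅x 1, x 2⁆]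
  abel

/-! ### The grading -/

/-- The graded component `C^1_k`, spanned by `e^k` if `1 ≤ k ≤ p` and zero otherwise. -/
noncomputable def C₁ (F : Type*) [Field F] (p k : ℕ) : Submodule F (Module.Dual F (Trunc F p)) :=
  Submodule.span F {ψ | 1 ≤ k ∧ k ≤ p ∧ ψ = dual F p k}

/-- The graded component `C^2_k`, spanned by the `e^{i,j}` with `1 ≤ i < j ≤ p`, `i + j = k`. -/
noncomputable def C₂ (F : Type*) [Field F] (p k : ℕ) : Submodule F (Cochain F p 2) :=
  Submodule.span F {φ | ∃ i j : ℕ, 1 ≤ i ∧ i < j ∧ j ≤ p ∧ i + j = k ∧ φ = dual₂ F p i j}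

/-- `ker d^2_k`, where `d^2_k` is the restriction of `d^2` to `C^2_k`. -/
noncomputable def Z₂ (F : Type*) [Field F] (p k : ℕ) : Submodule F (Cochain F p 2) :=
  C₂ F p k ⊓ LinearMap.ker (d₂ F p)

/-- The image of `d^1_k`, where `d^1_k` is the restriction of `d^1` to `C^1_k`. -/
noncomputable def B₂ (F : Type*) [Field F] (p k : ℕ) : Submodule F (Cochain F p 2) :=
  (C₁ F p k).map (d₁ F p)

/-- `s(k) = k/2 - 1` for even `k` and `s(k) = (k-1)/2` for odd `k`. -/
def s (k : ℕ) : ℕ := if Even k then k / 2 - 1 else (k - 1) / 2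

/-- `M(p,k) = 1` for `k ≤ p + 1` and `M(p,k) = k - p` for `k ≥ p + 2`. -/
def M (p k : ℕ) : ℕ := if k ≤ p + 1 then 1 else k - p

/-- `φ_k = ∑_{i = M(p,k)}^{s(k)} a_{i,k-i} e^{i,k-i}`. -/
noncomputable def φ (F : Type*) [Field F] (p k : ℕ) : Cochain F p 2 :=
  ∑ i ∈ Finset.Icc (M p k) (s k), a F i (k - i) • dual₂ F p i (k - i)

/-- The `k`-th graded component `H^2_k = ker d^2_k / im d^1_k` of the second cohomology space,
realized as a subspace of `C^2 / im d^1_k`: the image of `ker d^2_k`. -/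
noncomputable def H₂ (F : Type*) [Field F] (p k : ℕ) : Submodule F (Cochain F p 2 ⧸ B₂ F p k) :=
  (Z₂ F p k).map (B₂ F p k).mkQ

/-- The vectors `v 0, …, v (n - 1)` form a basis of the subspace `W`. -/
def IsBasisOf {F V : Type*} [Field F] [AddCommGroup V] [Module F V] {n : ℕ} (v : Fin n → V)
    (W : Submodule F V) : Prop :=
  LinearIndependent F v ∧ Submodule.span F (Set.range v) = W

/-- `c` lies in `ker d^2_k` and its class forms a basis of `H^2_k`. -/
def ClassIsBasis (F : Type*) [Field F] (p k : ℕ) (c : Cochain F p 2) : Prop :=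
  c ∈ Z₂ F p k ∧ IsBasisOf ![(B₂ F p k).mkQ c] (H₂ F p k)

end AffineNilp

namespace AffineNilp

/-! ### Structure constants by residue class modulo 3 -/

section StructureConstants

variable (F : Type*) [Field F] {i j : ℕ}

/-! A cocycle `ψ` of weight `k` is the sequence `x l = ψ(e_l, e_{k-l})`, antisymmetric under `l ↦ k
- l` and subject to one linear relation for each `i + j + l = k`. Relations containing the index 1
or 2 form a recursion that determines `x` from `x 1` and `x 2` (`IsCocycleSeq.eq_zero`), so each
kernel has dimension at most 2.

Antisymmetry and the remaining relations usually cost one more dimension, depending on `k` mod 3. If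
`k ≡ 0` and `k ≠ 0` in `F`, then `x 1 = 0` forces `x 2 = 0`; if `k ≡ 1` and `k ≠ 7`, then `x 2 = 0`;
if `k ≡ 2` and `k ≠ 5`, then `x 1 = 0`. Weights 5 and 7 are too small for the relations used, which
is where `e^{1,4}` and `e^{2,5}` come from.

For `k ≤ p + 1` the form `φ_k` is a nonzero cocycle by the Jacobi identity, and it spans the kernel
outside weights 5 and 7. It is `d^1(e^k)` for `k ≤ p`; in weight `p + 1` there is no `e^{p+1}` to
bound it, so its class survives. For `k ≥ p + 2` the vanishing of `e_{p+1}, e_{p+2}, …` in `g(p)` (a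
consequence of `3 ∤ p`) gives `x 1 = 0`, and also `x 2 = 0` once `k ≥ p + 3`; weight `p + 2` is
settled by the congruence cases. -/

theorem a_eq_zero (h : i % 3 = j % 3) : a F i j = 0 := by
  unfold a
  split_ifs <;> first | omega | rfl

theorem a_eq_one (h : (i + 1) % 3 = j % 3) : a F i j = 1 := by
  unfold a
  split_ifs <;> first | omega | rfl

theorem a_eq_neg_one (h : i % 3 = (j + 1) % 3) : a F i j = -1 := by
  unfold a
  split_ifs <;> first | omega | rfl

end StructureConstants

/-! ### Homogeneous cocycles as sequences of scalars -/

/-- The sequence `x l = ψ (e_l, e_{k-l})` of values of a homogeneous 2-cocycle `ψ` of weight `k`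
on `n_+(A_1^{(1)})`. -/
structure IsCocycleSeq {F : Type*} [Field F] (k : ℕ) (x : ℕ → F) : Prop where
  antisymm : ∀ l, 0 < l → l < k → x (k - l) = - x l
  rel : ∀ i j l, 0 < i → 0 < j → 0 < l → i + j + l = k →
    a F i j * x l + a F l i * x j + a F j l * x i = 0

namespace IsCocycleSeq

variable {F : Type*} [Field F] {k : ℕ} {x : ℕ → F}

theorem step (hx : IsCocycleSeq k x) {m l : ℕ} (hm : 0 < m) (hl : 0 < l) (h : l + m < k) :
    a F m l * x (l + m) = a F (k - m - l) m * x l + a F l (k - m - l) * x m := by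
  have h1 := hx.rel m l (k - m - l) hm hl (by omega) (by omega)
  have h2 := hx.antisymm (l + m) (by omega) h
  rw [show k - (l + m) = k - m - l by omega] at h2
  rw [h2] at h1
  linear_combination -h1

/-- The coefficient of `x l` in the recursion with `m = 1` is nonzero unless `l ≡ 2` mod 3, and in
that case the recursion with `m = 2` has coefficient 1. -/
theorem eq_zero (hx : IsCocycleSeq k x) (h1 : x 1 = 0) (h2 : x 2 = 0) :
    ∀ l, 0 < l → l < k → x l = 0 := by
  intro l
  induction l using Nat.strong_induction_on with
  | _ l ih =>
    intro hl hlk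
    rcases (show l = 1 ∨ l = 2 ∨ 3 ≤ l by omega) with rfl | rfl | h3
    · exact h1
    · exact h2
    have s1 := hx.step (m := 1) (l := l - 1) (by omega) (by omega) (by omega)
    have s2 := hx.step (m := 2) (l := l - 2) (by omega) (by omega) (by omega)
    rw [show l - 1 + 1 = l by omega, h1, ih (l - 1) (by omega) (by omega) (by omega)] at s1
    rw [show l - 2 + 2 = l by omega, h2, ih (l - 2) (by omega) (by omega) (by omega)] at s2
    rcases (show l % 3 = 0 ∨ l % 3 = 1 ∨ l % 3 = 2 by omega) with h | h | h
    · rw [a_eq_one F (by omega)] at s1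
      simpa using s1
    · rw [a_eq_neg_one F (by omega)] at s1
      simpa using s1
    · rw [a_eq_one F (by omega)] at s2
      simpa using s2

theorem apply_two_eq_zero_of_mod_eq_zero (hx : IsCocycleSeq k x) (hk : k % 3 = 0)
    (hk0 : (k : F) ≠ 0) (h1 : x 1 = 0) : x 2 = 0 := by
  -- With `x 1 = 0` the recursion gives `x(3t+3) = x(3t+2)` and `x(3t+5) = x(3t+3) + x 2`. At the
  -- far end `x(k-1) = -x 1 = 0` this reads `(k/3) * x 2 = 0`.
  have key : ∀ t, 3 * t + 2 < k → x (3 * t + 2) = (t + 1) * x 2 := by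
    intro t
    induction t with
    | zero => simp
    | succ t ih =>
      intro ht
      have s1 := hx.step (m := 1) (l := 3 * t + 2) (by omega) (by omega) (by omega)
      have s2 := hx.step (m := 2) (l := 3 * t + 3) (by omega) (by omega) (by omega)
      rw [a_eq_one F (by omega), a_eq_one F (by omega), ih (by omega), h1] at s1
      rw [a_eq_one F (by omega), a_eq_one F (by omega), a_eq_one F (by omega)] at s2
      rw [show 3 * (t + 1) + 2 = 3 * t + 3 + 2 by ring]
      push_cast
      linear_combination s2 + s1
  obtain ⟨m, rfl⟩ : ∃ m, k = 3 * (m + 1) := by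
    refine ⟨k / 3 - 1, ?_⟩
    have : k ≠ 0 := by rintro rfl; simp at hk0
    omega
  have h2 := key m (by omega)
  have h3 := hx.antisymm 1 (by omega) (by omega)
  rw [show 3 * (m + 1) - 1 = 3 * m + 2 by omega, h2, h1, neg_zero] at h3
  refine (mul_eq_zero.1 h3).resolve_left fun h => hk0 ?_
  push_cast
  rw [h, mul_zero]

theorem apply_two_eq_zero_of_mod_eq_one (hx : IsCocycleSeq k x) (hk : k % 3 = 1) (hk3 : 3 ≤ k)
    (hk7 : k ≠ 7) (h2 : (2 : F) ≠ 0) : x 2 = 0 := by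
  rcases (show k = 4 ∨ 10 ≤ k by omega) with rfl | hk10
  · have h := hx.antisymm 2 (by omega) (by omega)
    refine (mul_eq_zero.1 (show 2 * x 2 = 0 from ?_)).resolve_left h2
    linear_combination h
  -- The relation on `2, l, k-2-l` has vanishing leading coefficient, hence `x l = x 2`. Both 5 and
  -- `k - 5` are `≡ 2` mod 3, so antisymmetry yields `x 2 = -x 2`. For `k = 7` the third index `k -
  -- 2 - 5` would be 0.
  · have key : ∀ l, 0 < l → l % 3 = 2 → l + 2 < k → x l = x 2 := by
      intro l hl hl3 hlk
      have s := hx.step (m := 2) (l := l) (by omega) hl hlk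
      rw [a_eq_zero F (by omega), a_eq_neg_one F (by omega), a_eq_one F (by omega)] at s
      linear_combination s
    have h := hx.antisymm 5 (by omega) (by omega)
    rw [key 5 (by omega) (by omega) (by omega), key (k - 5) (by omega) (by omega) (by omega)] at h
    refine (mul_eq_zero.1 (show 2 * x 2 = 0 from ?_)).resolve_left h2
    linear_combination h

theorem apply_one_eq_zero_of_mod_eq_two (hx : IsCocycleSeq k x) (hk : k % 3 = 2) (hk3 : 3 ≤ k)
    (hk5 : k ≠ 5) (h2 : (2 : F) ≠ 0) : x 1 = 0 := by
  -- These two relations give `x 4 = -x 1` and `x 4 = x 1`. The second needs `5 < k`, which excludes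
  -- weight 5.
  have s := hx.step (m := 1) (l := 3) (by omega) (by omega) (by omega)
  have s' := hx.step (m := 1) (l := 4) (by omega) (by omega) (by omega)
  rw [a_eq_neg_one F (by omega), a_eq_zero F (by omega), a_eq_one F (by omega)] at s
  rw [a_eq_zero F (by omega), a_eq_one F (by omega), a_eq_neg_one F (by omega)] at s'
  refine (mul_eq_zero.1 (show 2 * x 1 = 0 from ?_)).resolve_left h2
  norm_num at s s'
  linear_combination s' - s

end IsCocycleSeq

/-! ### Values of cochains on basis vectors -/

section Values

variable (F : Type*) [Field F] (p : ℕ)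

theorem lie_e (i j : ℕ+) : ⁅e F p i, e F p j⁆ = a F i j • e F p (i + j) := by
  change LieSubmodule.Quotient.mk ⁅NPlus.basis F i, NPlus.basis F j⁆ = _
  rw [NPlus.lie_basis]
  rfl

/-- The image of `e_i` in `g(p)`, with `e_0 = 0`. -/
noncomputable def eNat (i : ℕ) : Trunc F p := if h : 0 < i then e F p ⟨i, h⟩ else 0

theorem eNat_coe (i : ℕ+) : eNat F p i = e F p i := by
  rw [eNat, dif_pos i.pos]
  rfl

theorem lie_eNat {i j : ℕ} (hi : 0 < i) (hj : 0 < j) :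
    ⁅eNat F p i, eNat F p j⁆ = a F i j • eNat F p (i + j) := by
  lift i to ℕ+ using hi
  lift j to ℕ+ using hj
  rw [← PNat.add_coe, eNat_coe, eNat_coe, eNat_coe, lie_e]

theorem eNat_eq_zero (hp : ¬ 3 ∣ p) {i : ℕ} (hi : p < i) : eNat F p i = 0 := by
  lift i to ℕ+ using by omega
  rw [eNat_coe, e_eq_zero F p hp i hi]

theorem dual_eNat {k j : ℕ} (hk : 0 < k) (hkp : k ≤ p) :
    dual F p k (eNat F p j) = if j = k then 1 else 0 := by
  rcases Nat.eq_zero_or_pos j with rfl | hj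
  · rw [if_neg (by omega), eNat, dif_neg (by omega), map_zero]
  · lift j to ℕ+ using hj
    rw [eNat_coe, dual_e F p k hk hkp]

theorem dual₂_eNat {i j l m : ℕ} (hi : 0 < i) (hip : i ≤ p) (hj : 0 < j) (hjp : j ≤ p) :
    dual₂ F p i j ![eNat F p l, eNat F p m] =
      (if l = i ∧ m = j then 1 else 0) - if l = j ∧ m = i then 1 else 0 := by
  rw [dual₂_apply, dual_eNat F p hi hip, dual_eNat F p hj hjp, dual_eNat F p hi hip,
    dual_eNat F p hj hjp]
  simp only [ite_and, mul_ite, mul_one, mul_zero]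
  split_ifs <;> simp

/-! ### Testing cochains on basis vectors -/

variable {F p}

/-- Pulling back along the surjection from `NPlus F` reduces equality to its basis, so no basis of
the quotient is needed; indices above `p` are tested as well. -/
theorem alternating_ext {n : ℕ} {ψ χ : Cochain F p n}
    (h : ∀ v : Fin n → ℕ, (∀ i, 0 < v i) → Function.Injective v →
      ψ (fun i => eNat F p (v i)) = χ (fun i => eNat F p (v i))) : ψ = χ := by
  let π : NPlus F →ₗ[F] Trunc F p := (truncIdeal F p).toSubmodule.mkQ
  have hπ : Function.Surjective π := Submodule.mkQ_surjective _
  refine AlternatingMap.compLinearMap_injective π hπ ?_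
  refine (NPlus.basis F).ext_alternating fun v hv => ?_
  have := h (fun i => v i) (fun i => (v i).pos) fun i j hij => hv (PNat.eq hij)
  simp only [eNat_coe] at this
  exact this

theorem d₂_apply (ψ : Cochain F p 2) (g h f : Trunc F p) :
    d₂ F p ψ ![g, h, f] = ψ ![⁅g, h⁆, f] - ψ ![⁅g, f⁆, h] + ψ ![⁅h, f⁆, g] := rfl

theorem d₂_eNat (ψ : Cochain F p 2) {i j l : ℕ} (hi : 0 < i) (hj : 0 < j) (hl : 0 < l) :
    d₂ F p ψ ![eNat F p i, eNat F p j, eNat F p l] =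
      a F i j * ψ ![eNat F p (i + j), eNat F p l] - a F i l * ψ ![eNat F p (i + l), eNat F p j]
        + a F j l * ψ ![eNat F p (j + l), eNat F p i] := by
  rw [d₂_apply, lie_eNat F p hi hj, lie_eNat F p hi hl, lie_eNat F p hj hl]
  simp only [cochain_smul_left]

theorem C₂_eNat {k : ℕ} {ψ : Cochain F p 2} (hψ : ψ ∈ C₂ F p k) {i j : ℕ} (h : i + j ≠ k) :
    ψ ![eNat F p i, eNat F p j] = 0 := by
  induction hψ using Submodule.span_induction with
  | zero => rfl
  | add u v _ _ hu hv => rw [AlternatingMap.add_apply, hu, hv, add_zero]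
  | smul t u _ hu => rw [AlternatingMap.smul_apply, hu, smul_zero]
  | mem u hu =>
    obtain ⟨r, t, hr, hrt, ht, hk, rfl⟩ := hu
    rw [dual₂_eNat F p (by omega) (by omega) (by omega) (by omega), if_neg (by omega),
      if_neg (by omega), sub_zero]

theorem mem_Z₂ {k : ℕ} {ψ : Cochain F p 2} (hψ : ψ ∈ C₂ F p k)
    (h : ∀ i j l, 0 < i → 0 < j → 0 < l → i ≠ j → i ≠ l → j ≠ l → i + j + l = k →
      a F i j * ψ ![eNat F p (i + j), eNat F p l] - a F i l * ψ ![eNat F p (i + l), eNat F p j]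
        + a F j l * ψ ![eNat F p (j + l), eNat F p i] = 0) : ψ ∈ Z₂ F p k := by
  refine ⟨hψ, alternating_ext fun v hv hinj => ?_⟩
  rw [show (fun i => eNat F p (v i)) = ![eNat F p (v 0), eNat F p (v 1), eNat F p (v 2)] by
    ext i; fin_cases i <;> rfl, d₂_eNat ψ (hv 0) (hv 1) (hv 2), AlternatingMap.zero_apply]
  by_cases hk : v 0 + v 1 + v 2 = k
  · exact h _ _ _ (hv 0) (hv 1) (hv 2) (hinj.ne (by decide)) (hinj.ne (by decide))
      (hinj.ne (by decide)) hk
  · rw [C₂_eNat hψ (by omega), C₂_eNat hψ (by omega), C₂_eNat hψ (by omega)]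
    ring

theorem isCocycleSeq_of_mem_Z₂ {k : ℕ} {ψ : Cochain F p 2} (hψ : ψ ∈ Z₂ F p k) :
    IsCocycleSeq k fun l => ψ ![eNat F p l, eNat F p (k - l)] where
  antisymm l hl hlk := by
    rw [show k - (k - l) = l by omega]
    exact cochain_swap ψ _ _
  rel i j l hi hj hl hk := by
    have h : d₂ F p ψ = 0 := hψ.2
    have h1 := d₂_eNat ψ hi hj hl
    rw [h, AlternatingMap.zero_apply, cochain_swap ψ _ (eNat F p l), cochain_swap ψ _ (eNat F p j),
      cochain_swap ψ _ (eNat F p i)] at h1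
    simp only [show k - l = i + j by omega, show k - j = i + l by omega,
      show k - i = j + l by omega, a_swap F i l]
    linear_combination h1

theorem eq_zero_of_mem_Z₂ {k : ℕ} {ψ : Cochain F p 2} (hψ : ψ ∈ Z₂ F p k)
    (h1 : ψ ![eNat F p 1, eNat F p (k - 1)] = 0) (h2 : ψ ![eNat F p 2, eNat F p (k - 2)] = 0) :
    ψ = 0 := by
  refine alternating_ext fun v hv _ => ?_
  rw [show (fun i => eNat F p (v i)) = ![eNat F p (v 0), eNat F p (v 1)] by
    ext i; fin_cases i <;> rfl]
  by_cases h : v 0 + v 1 = k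
  · have := (isCocycleSeq_of_mem_Z₂ hψ).eq_zero h1 h2 (v 0) (hv 0) (by have := hv 1; omega)
    rw [AlternatingMap.zero_apply]
    simpa only [show k - v 0 = v 1 by omega] using this
  · exact C₂_eNat hψ.1 h

theorem sum_cochain_apply {ι : Type*} {n : ℕ} (t : Finset ι) (f : ι → Cochain F p n)
    (v : Fin n → Trunc F p) : (∑ i ∈ t, f i) v = ∑ i ∈ t, f i v := by
  classical
  induction t using Finset.induction_on with
  | empty => rfl
  | insert i t hi ih => rw [Finset.sum_insert hi, Finset.sum_insert hi, AlternatingMap.add_apply, ih]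

/-! ### The explicit cocycles -/

theorem dual₂_mem_C₂ {i j k : ℕ} (hi : 0 < i) (hij : i < j) (hj : j ≤ p) (hk : i + j = k) :
    dual₂ F p i j ∈ C₂ F p k :=
  Submodule.subset_span ⟨i, j, hi, hij, hj, hk, rfl⟩

/-- The bounds `M` and `s` are exactly what makes `e^{i,k-i}` one of the basis forms of `C^2_k`. -/
theorem mem_Icc_M_s {k i : ℕ} (hi : i ∈ Finset.Icc (M p k) (s k)) :
    0 < i ∧ i < k - i ∧ k - i ≤ p := by
  simp only [Finset.mem_Icc, M, s, Nat.even_iff] at hi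
  split_ifs at hi <;> omega

theorem φ_mem_C₂ (k : ℕ) : φ F p k ∈ C₂ F p k := by
  refine Submodule.sum_mem _ fun i hi => Submodule.smul_mem _ _ ?_
  have := mem_Icc_M_s hi
  exact dual₂_mem_C₂ this.1 this.2.1 this.2.2 (by omega)

theorem φ_eNat {i j k : ℕ} (hi : 0 < i) (hip : i ≤ p) (hj : 0 < j) (hjp : j ≤ p)
    (h : i + j = k) : φ F p k ![eNat F p i, eNat F p j] = a F i j := by
  have key : ∀ i j, 0 < i → i < j → j ≤ p → i + j = k →
      φ F p k ![eNat F p i, eNat F p j] = a F i j := by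
    intro i j hi hij hj h
    have hterm : ∀ r ∈ Finset.Icc (M p k) (s k),
        (a F r (k - r) • dual₂ F p r (k - r)) ![eNat F p i, eNat F p j] =
          if i = r then a F i j else 0 := by
      intro r hr
      have := mem_Icc_M_s hr
      rw [AlternatingMap.smul_apply, dual₂_eNat F p (by omega) (by omega) (by omega) (by omega),
        smul_eq_mul]
      by_cases hir : i = r
      · rw [if_pos (by omega), if_neg (by omega), if_pos hir, ← hir, show k - i = j by omega]
        simp
      · rw [if_neg (by omega), if_neg (by omega), if_neg hir]
        simp
    rw [φ, sum_cochain_apply, Finset.sum_congr rfl hterm, Finset.sum_ite_eq, if_pos]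
    simp only [Finset.mem_Icc, M, s, Nat.even_iff]
    split_ifs <;> omega
  rcases lt_trichotomy i j with hij | rfl | hij
  · exact key i j hi hij hjp h
  · rw [cochain_self, a_self]
  · rw [cochain_swap, key j i hj hij hip (by omega), a_swap, neg_neg]

theorem φ_eq_d₁ {k : ℕ} (hk : 3 ≤ k) (hkp : k ≤ p) :
    φ F p k = d₁ F p (dual F p k) := by
  refine alternating_ext fun v hv _ => ?_
  rw [show (fun i => eNat F p (v i)) = ![eNat F p (v 0), eNat F p (v 1)] by
    ext i; fin_cases i <;> rfl]
  have h0 := hv 0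
  have h1 := hv 1
  change _ = dual F p k ⁅eNat F p (v 0), eNat F p (v 1)⁆
  rw [lie_eNat F p h0 h1, map_smul, dual_eNat F p (by omega) hkp, smul_eq_mul]
  by_cases h : v 0 + v 1 = k
  · rw [φ_eNat h0 (by omega) h1 (by omega) h, if_pos h, mul_one]
  · rw [C₂_eNat (φ_mem_C₂ k) h, if_neg h, mul_zero]

/-- Since `i + j + l = k ≤ p + 1`, every index that occurs is at most `p`, and the cocycle condition
becomes the Jacobi identity for the `a_{i,j}`. This covers `k = p + 1`, where `d^2 ∘ d^1 = 0` does
not apply. -/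
theorem φ_mem_Z₂ {k : ℕ} (hkp : k ≤ p + 1) : φ F p k ∈ Z₂ F p k := by
  refine mem_Z₂ (φ_mem_C₂ k) fun i j l hi hj hl _ _ _ h => ?_
  rw [φ_eNat (by omega) (by omega) (by omega) (by omega) (by omega),
    φ_eNat (by omega) (by omega) (by omega) (by omega) (by omega),
    φ_eNat (by omega) (by omega) (by omega) (by omega) (by omega), a_swap F i (j + l),
    a_swap F j (i + l)]
  linear_combination -a_jacobi F i j l

theorem dual₂_one_four_mem_Z₂ (hp : 4 ≤ p) : dual₂ F p 1 4 ∈ Z₂ F p 5 :=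
  -- No three distinct positive integers sum to 5.
  mem_Z₂ (dual₂_mem_C₂ one_pos (by omega) hp rfl) fun i j l _ _ _ _ _ _ _ => by omega

theorem dual₂_two_five_mem_Z₂ (hp : 5 ≤ p) : dual₂ F p 2 5 ∈ Z₂ F p 7 := by
  refine mem_Z₂ (dual₂_mem_C₂ two_pos (by omega) hp rfl) fun i j l _ _ _ _ _ _ _ => ?_
  simp only [dual₂_eNat F p two_pos (by omega : 2 ≤ p) (by omega : 0 < 5) hp]
  have hi : i ≤ 4 := by omega
  have hj : j ≤ 4 := by omega
  obtain rfl : l = 7 - i - j := by omega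
  -- The only triple is `{1, 2, 4}`, and its one possible contribution, `[e_1, e_4]` paired with
  -- `e_2`, vanishes because `a_{1,4} = 0`.
  interval_cases i <;> interval_cases j <;> first | omega | simp [a]

/-- In weights `k ≠ 5, 7` a cocycle is determined by one of its first two values. -/
theorem mem_span_φ (h2 : (2 : F) ≠ 0) {k : ℕ} (hk : 3 ≤ k) (hkp : k ≤ p + 1) (hk5 : k ≠ 5)
    (hk7 : k ≠ 7) (hk0 : k % 3 = 0 → (k : F) ≠ 0) {ψ : Cochain F p 2} (hψ : ψ ∈ Z₂ F p k) :
    ∃ c : F, c • φ F p k = ψ := by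
  have hφ := φ_mem_Z₂ (F := F) hkp
  have φ1 : φ F p k ![eNat F p 1, eNat F p (k - 1)] = a F 1 (k - 1) :=
    φ_eNat (by omega) (by omega) (by omega) (by omega) (by omega)
  have φ2 : φ F p k ![eNat F p 2, eNat F p (k - 2)] = a F 2 (k - 2) :=
    φ_eNat (by omega) (by omega) (by omega) (by omega) (by omega)
  have hsub : ∀ c : F, ψ - c • φ F p k ∈ Z₂ F p k := fun c =>
    sub_mem hψ (Submodule.smul_mem _ c hφ)
  -- Subtract the multiple of `φ_k` that matches `ψ` at index 1, or at index 2 when `k ≡ 2`, where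
  -- `a_{1,k-1} = 0`. The congruence lemma kills the other initial value.
  rcases (show k % 3 = 0 ∨ k % 3 = 1 ∨ k % 3 = 2 by omega) with h | h | h
  · refine ⟨ψ ![eNat F p 1, eNat F p (k - 1)], (sub_eq_zero.1 ?_).symm⟩
    have h1 : (ψ - ψ ![eNat F p 1, eNat F p (k - 1)] • φ F p k)
        ![eNat F p 1, eNat F p (k - 1)] = 0 := by
      rw [AlternatingMap.sub_apply, AlternatingMap.smul_apply, φ1, a_eq_one F (by omega)]
      simp
    exact eq_zero_of_mem_Z₂ (hsub _) h1
      ((isCocycleSeq_of_mem_Z₂ (hsub _)).apply_two_eq_zero_of_mod_eq_zero h (hk0 h) h1)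
  · refine ⟨-ψ ![eNat F p 1, eNat F p (k - 1)], (sub_eq_zero.1 ?_).symm⟩
    refine eq_zero_of_mem_Z₂ (hsub _) ?_
      ((isCocycleSeq_of_mem_Z₂ (hsub _)).apply_two_eq_zero_of_mod_eq_one h hk hk7 h2)
    rw [AlternatingMap.sub_apply, AlternatingMap.smul_apply, φ1, a_eq_neg_one F (by omega)]
    simp
  · refine ⟨ψ ![eNat F p 2, eNat F p (k - 2)], (sub_eq_zero.1 ?_).symm⟩
    refine eq_zero_of_mem_Z₂ (hsub _)
      ((isCocycleSeq_of_mem_Z₂ (hsub _)).apply_one_eq_zero_of_mod_eq_two h hk hk5 h2) ?_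
    rw [AlternatingMap.sub_apply, AlternatingMap.smul_apply, φ2, a_eq_one F (by omega)]
    simp

theorem φ_ne_zero {k : ℕ} (hk : 3 ≤ k) (hkp : k ≤ p + 1) : φ F p k ≠ 0 := by
  intro h
  have φ1 : φ F p k ![eNat F p 1, eNat F p (k - 1)] = a F 1 (k - 1) :=
    φ_eNat (by omega) (by omega) (by omega) (by omega) (by omega)
  have φ2 : φ F p k ![eNat F p 2, eNat F p (k - 2)] = a F 2 (k - 2) :=
    φ_eNat (by omega) (by omega) (by omega) (by omega) (by omega)
  rw [h, AlternatingMap.zero_apply] at φ1 φ2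
  rcases (show k % 3 = 0 ∨ k % 3 = 1 ∨ k % 3 = 2 by omega) with h | h | h
  · rw [a_eq_one F (by omega)] at φ1
    exact zero_ne_one φ1
  · rw [a_eq_neg_one F (by omega)] at φ1
    exact neg_ne_zero.2 one_ne_zero φ1.symm
  · rw [a_eq_one F (by omega)] at φ2
    exact zero_ne_one φ2

/-! ### Bases of the cocycle spaces -/

theorem isBasisOf_singleton {V : Type*} [AddCommGroup V] [Module F V] {v : V}
    {W : Submodule F V} (hv : v ≠ 0) (hvW : v ∈ W) (h : ∀ w ∈ W, ∃ c : F, c • v = w) :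
    IsBasisOf ![v] W := by
  refine ⟨LinearIndependent.of_subsingleton 0 (by simpa using hv), le_antisymm ?_ ?_⟩
  · rw [Submodule.span_le]
    rintro _ ⟨i, rfl⟩
    fin_cases i
    exact hvW
  · intro w hw
    obtain ⟨c, rfl⟩ := h w hw
    exact Submodule.smul_mem _ c (Submodule.subset_span ⟨0, rfl⟩)

theorem isBasisOf_pair {V : Type*} [AddCommGroup V] [Module F V] {v w : V}
    {W : Submodule F V} (hli : ∀ c d : F, c • v + d • w = 0 → c = 0 ∧ d = 0) (hv : v ∈ W)
    (hw : w ∈ W) (h : ∀ u ∈ W, ∃ c d : F, c • v + d • w = u) : IsBasisOf ![v, w] W := by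
  refine ⟨LinearIndependent.pair_iff.2 hli, le_antisymm ?_ ?_⟩
  · rw [Submodule.span_le]
    rintro _ ⟨i, rfl⟩
    fin_cases i
    exacts [hv, hw]
  · intro u hu
    obtain ⟨c, d, rfl⟩ := h u hu
    exact add_mem (Submodule.smul_mem _ c (Submodule.subset_span ⟨0, rfl⟩))
      (Submodule.smul_mem _ d (Submodule.subset_span ⟨1, rfl⟩))

theorem isBasisOf_φ (h2 : (2 : F) ≠ 0) {k : ℕ} (hk : 3 ≤ k) (hkp : k ≤ p + 1) (hk5 : k ≠ 5)
    (hk7 : k ≠ 7) (hk0 : k % 3 = 0 → (k : F) ≠ 0) : IsBasisOf ![φ F p k] (Z₂ F p k) :=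
  isBasisOf_singleton (φ_ne_zero hk hkp) (φ_mem_Z₂ hkp)
    fun _ hψ => mem_span_φ h2 hk hkp hk5 hk7 hk0 hψ

theorem isBasisOf_Z₂_five (hp : 5 ≤ p) : IsBasisOf ![dual₂ F p 1 4, φ F p 5] (Z₂ F p 5) := by
  have hd := dual₂_one_four_mem_Z₂ (F := F) (show 4 ≤ p by omega)
  have hφ := φ_mem_Z₂ (F := F) (show 5 ≤ p + 1 by omega)
  have v1 : ∀ c d : F, (c • dual₂ F p 1 4 + d • φ F p 5) ![eNat F p 1, eNat F p 4] = c := by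
    intro c d
    rw [AlternatingMap.add_apply, AlternatingMap.smul_apply, AlternatingMap.smul_apply,
      φ_eNat (by omega) (by omega) (by omega) (by omega) (by omega), a_eq_zero F (by omega),
      dual₂_eNat F p (by omega) (by omega) (by omega) (by omega)]
    simp
  have v2 : ∀ c d : F, (c • dual₂ F p 1 4 + d • φ F p 5) ![eNat F p 2, eNat F p 3] = d := by
    intro c d
    rw [AlternatingMap.add_apply, AlternatingMap.smul_apply, AlternatingMap.smul_apply,
      φ_eNat (by omega) (by omega) (by omega) (by omega) (by omega), a_eq_one F (by omega),
      dual₂_eNat F p (by omega) (by omega) (by omega) (by omega)]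
    simp
  refine isBasisOf_pair (fun c d h => ⟨?_, ?_⟩) hd hφ fun ψ hψ =>
    ⟨ψ ![eNat F p 1, eNat F p 4], ψ ![eNat F p 2, eNat F p 3], (sub_eq_zero.1 ?_).symm⟩
  · rw [← v1 c d, h, AlternatingMap.zero_apply]
  · rw [← v2 c d, h, AlternatingMap.zero_apply]
  · refine eq_zero_of_mem_Z₂ (k := 5) (sub_mem hψ (add_mem (Submodule.smul_mem _ _ hd)
      (Submodule.smul_mem _ _ hφ))) ?_ ?_
    · rw [AlternatingMap.sub_apply, v1, sub_self]
    · rw [AlternatingMap.sub_apply, v2, sub_self]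

theorem isBasisOf_Z₂_seven (hp : 7 ≤ p) : IsBasisOf ![dual₂ F p 2 5, φ F p 7] (Z₂ F p 7) := by
  have hd := dual₂_two_five_mem_Z₂ (F := F) (show 5 ≤ p by omega)
  have hφ := φ_mem_Z₂ (F := F) (show 7 ≤ p + 1 by omega)
  have v1 : ∀ c d : F, (c • dual₂ F p 2 5 + d • φ F p 7) ![eNat F p 1, eNat F p 6] = -d := by
    intro c d
    rw [AlternatingMap.add_apply, AlternatingMap.smul_apply, AlternatingMap.smul_apply,
      φ_eNat (by omega) (by omega) (by omega) (by omega) (by omega), a_eq_neg_one F (by omega),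
      dual₂_eNat F p (by omega) (by omega) (by omega) (by omega)]
    simp
  have v2 : ∀ c d : F, (c • dual₂ F p 2 5 + d • φ F p 7) ![eNat F p 2, eNat F p 5] = c := by
    intro c d
    rw [AlternatingMap.add_apply, AlternatingMap.smul_apply, AlternatingMap.smul_apply,
      φ_eNat (by omega) (by omega) (by omega) (by omega) (by omega), a_eq_zero F (by omega),
      dual₂_eNat F p (by omega) (by omega) (by omega) (by omega)]
    simp
  refine isBasisOf_pair (fun c d h => ⟨?_, ?_⟩) hd hφ fun ψ hψ =>
    ⟨ψ ![eNat F p 2, eNat F p 5], -ψ ![eNat F p 1, eNat F p 6], (sub_eq_zero.1 ?_).symm⟩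
  · rw [← v2 c d, h, AlternatingMap.zero_apply]
  · rw [← neg_eq_zero, ← v1 c d, h, AlternatingMap.zero_apply]
  · refine eq_zero_of_mem_Z₂ (k := 7) (sub_mem hψ (add_mem (Submodule.smul_mem _ _ hd)
      (Submodule.smul_mem _ _ hφ))) ?_ ?_
    · rw [AlternatingMap.sub_apply, v1, neg_neg, sub_self]
    · rw [AlternatingMap.sub_apply, v2, sub_self]

theorem apply_eNat_eq_zero (hp : ¬ 3 ∣ p) (ψ : Cochain F p 2) {i j : ℕ} (hj : p < j) :
    ψ ![eNat F p i, eNat F p j] = 0 := by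
  rw [eNat_eq_zero F p hp hj]
  simpa using cochain_smul_right ψ 0 (eNat F p i) 0

theorem isBasisOf_Z₂_seven_of_eq_five : IsBasisOf ![dual₂ F 5 2 5] (Z₂ F 5 7) := by
  have hd := dual₂_two_five_mem_Z₂ (F := F) (show 5 ≤ 5 from le_rfl)
  have v2 : dual₂ F 5 2 5 ![eNat F 5 2, eNat F 5 5] = 1 := by
    rw [dual₂_eNat F 5 (by omega) (by omega) (by omega) (by omega)]
    simp
  refine isBasisOf_singleton (fun h => ?_) hd fun ψ hψ =>
    ⟨ψ ![eNat F 5 2, eNat F 5 5], (sub_eq_zero.1 ?_).symm⟩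
  · rw [h, AlternatingMap.zero_apply] at v2
    exact zero_ne_one v2
  · refine eq_zero_of_mem_Z₂ (k := 7) (sub_mem hψ (Submodule.smul_mem _ _ hd))
      -- For `p = 5` the value on `(e_1, e_6)` vanishes because `e_6 = 0`, so only the `e^{2,5}`
      -- coordinate remains.
      (apply_eNat_eq_zero (by omega) _ (by omega)) ?_
    rw [AlternatingMap.sub_apply, AlternatingMap.smul_apply, v2, smul_eq_mul, mul_one, sub_self]

theorem Z₂_eq_bot (hp : ¬ 3 ∣ p) (hp5 : 5 ≤ p) (h2 : (2 : F) ≠ 0) (hp0 : (p : F) = 0) {k : ℕ}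
    (hk : p + 2 ≤ k) (hk7 : ¬ (p = 5 ∧ k = 7)) : Z₂ F p k = ⊥ := by
  refine (Submodule.eq_bot_iff _).2 fun ψ hψ => ?_
  have h1 : ψ ![eNat F p 1, eNat F p (k - 1)] = 0 := apply_eNat_eq_zero hp ψ (by omega)
  refine eq_zero_of_mem_Z₂ hψ h1 ?_
  rcases Nat.eq_or_lt_of_le hk with rfl | hk
  -- In weight `p + 2` the value on `(e_2, e_p)` is not zero for free. As `3 ∤ p`, the weight is `≡
  -- 0` or `1` mod 3, and in the first case it equals `2 ≠ 0` in `F`.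
  · have hx := isCocycleSeq_of_mem_Z₂ hψ
    rcases (show (p + 2) % 3 = 0 ∨ (p + 2) % 3 = 1 by omega) with h | h
    · refine hx.apply_two_eq_zero_of_mod_eq_zero h ?_ h1
      push_cast
      rwa [hp0, zero_add]
    · exact hx.apply_two_eq_zero_of_mod_eq_one h (by omega) (by omega) h2
  · exact apply_eNat_eq_zero hp ψ (by omega)

theorem Z₂_eq_bot_of_lt_three {k : ℕ} (hk : k < 3) : Z₂ F p k = ⊥ := by
  refine eq_bot_iff.2 (inf_le_left.trans (Submodule.span_le.2 ?_))
  rintro _ ⟨i, j, hi, hij, _, h, _⟩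
  omega

/-! ### Coboundaries and cohomology -/

theorem B₂_eq_bot {k : ℕ} (hk : p < k) : B₂ F p k = ⊥ := by
  refine eq_bot_iff.2 (Submodule.map_le_iff_le_comap.2 (Submodule.span_le.2 ?_))
  rintro _ ⟨_, h, _⟩
  omega

theorem B₂_eq_span {k : ℕ} (hk : 3 ≤ k) (hkp : k ≤ p) : B₂ F p k = Submodule.span F {φ F p k} := by
  have : {ψ | 1 ≤ k ∧ k ≤ p ∧ ψ = dual F p k} = {dual F p k} := by
    ext ψ
    simp only [Set.mem_ofPred_eq, Set.mem_singleton_iff]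
    exact ⟨fun h => h.2.2, fun h => ⟨by omega, hkp, h⟩⟩
  rw [B₂, C₁, this, Submodule.map_span, Set.image_singleton, φ_eq_d₁ hk hkp]

theorem H₂_eq_bot_of_le {k : ℕ} (h : Z₂ F p k ≤ B₂ F p k) : H₂ F p k = ⊥ :=
  by
  rwa [H₂, eq_bot_iff, Submodule.map_le_iff_le_comap, ← LinearMap.ker, Submodule.ker_mkQ]

theorem classIsBasis_of_singleton {k : ℕ} {c : Cochain F p 2} (hc : IsBasisOf ![c] (Z₂ F p k))
    (hB : B₂ F p k = ⊥) : ClassIsBasis F p k c := by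
  have hmem : c ∈ Z₂ F p k := hc.2 ▸ Submodule.subset_span ⟨0, rfl⟩
  refine ⟨hmem, isBasisOf_singleton (fun h => ?_) (Submodule.mem_map_of_mem hmem) ?_⟩
  · rw [Submodule.mkQ_apply, Submodule.Quotient.mk_eq_zero, hB, Submodule.mem_bot] at h
    exact hc.1.ne_zero 0 h
  · rintro _ ⟨ψ, hψ, rfl⟩
    rw [← hc.2] at hψ
    obtain ⟨t, rfl⟩ := Submodule.mem_span_singleton.1 (by simpa using hψ)
    exact ⟨t, (map_smul _ _ _).symm⟩

theorem classIsBasis_of_pair {k : ℕ} {c b : Cochain F p 2} (hc : IsBasisOf ![c, b] (Z₂ F p k))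
    (hB : B₂ F p k = Submodule.span F {b}) : ClassIsBasis F p k c := by
  have hmem : c ∈ Z₂ F p k := hc.2 ▸ Submodule.subset_span ⟨0, rfl⟩
  refine ⟨hmem, isBasisOf_singleton (fun h => ?_) (Submodule.mem_map_of_mem hmem) ?_⟩
  · rw [Submodule.mkQ_apply, Submodule.Quotient.mk_eq_zero, hB] at h
    obtain ⟨t, ht⟩ := Submodule.mem_span_singleton.1 h
    have := (LinearIndependent.pair_iff.1 hc.1 1 (-t) (by rw [one_smul, neg_smul, ht]; abel)).1
    exact one_ne_zero this
  · rintro _ ⟨ψ, hψ, rfl⟩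
    rw [← hc.2] at hψ
    obtain ⟨u, t, rfl⟩ := Submodule.mem_span_pair.1 (by simpa using hψ)
    have hb : (B₂ F p k).mkQ b = 0 := by
      rw [Submodule.mkQ_apply, Submodule.Quotient.mk_eq_zero, hB]
      exact Submodule.mem_span_singleton_self b
    exact ⟨t, by rw [map_add, map_smul, map_smul, hb, smul_zero, zero_add]⟩

end Values

end AffineNilp

/-! ### The main theorem -/

theorem mainTheorem2 (p : ℕ) [Fact p.Prime] (hp : 5 ≤ p) (F : Type*) [Field F] [CharP F p] :
    -- the kernels of the graded differentials
    (∀ k : ℕ, p + 2 ≤ k → ¬ (p = 5 ∧ k = 7) → AffineNilp.Z₂ F p k = ⊥) ∧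
    (∀ k : ℕ, 3 ≤ k → k < p + 2 → k ≠ 5 → k ≠ 7 →
      AffineNilp.IsBasisOf ![AffineNilp.φ F p k] (AffineNilp.Z₂ F p k)) ∧
    AffineNilp.IsBasisOf ![AffineNilp.dual₂ F p 1 4, AffineNilp.φ F p 5] (AffineNilp.Z₂ F p 5) ∧
    (p = 5 → AffineNilp.IsBasisOf ![AffineNilp.dual₂ F p 2 5] (AffineNilp.Z₂ F p 7)) ∧
    (5 < p → AffineNilp.IsBasisOf ![AffineNilp.dual₂ F p 2 5, AffineNilp.φ F p 7]
      (AffineNilp.Z₂ F p 7)) ∧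
    -- the coboundaries
    (∀ k : ℕ, 3 ≤ k → k ≤ p → AffineNilp.φ F p k = AffineNilp.d₁ F p (AffineNilp.dual F p k)) ∧
    -- the graded components of the cohomology
    (∀ k : ℕ, k ≠ 5 → k ≠ 7 → k ≠ p + 1 → AffineNilp.H₂ F p k = ⊥) ∧
    AffineNilp.ClassIsBasis F p 5 (AffineNilp.dual₂ F p 1 4) ∧
    AffineNilp.ClassIsBasis F p 7 (AffineNilp.dual₂ F p 2 5) ∧
    AffineNilp.ClassIsBasis F p (p + 1) (AffineNilp.φ F p (p + 1)) := by
  have hprime : p.Prime := Fact.out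
  have hp3 : ¬ 3 ∣ p := fun h => by
    have := (Nat.prime_dvd_prime_iff_eq Nat.prime_three hprime).1 h
    omega
  have hp0 : (p : F) = 0 := CharP.cast_eq_zero F p
  have hcast : ∀ n : ℕ, 0 < n → n < p → (n : F) ≠ 0 := fun n hn hnp h =>
    absurd (Nat.le_of_dvd hn ((CharP.cast_eq_zero_iff F p n).1 h)) (by omega)
  have h2 : (2 : F) ≠ 0 := by exact_mod_cast hcast 2 (by omega) (by omega)
  have hZ : ∀ k : ℕ, p + 2 ≤ k → ¬ (p = 5 ∧ k = 7) → AffineNilp.Z₂ F p k = ⊥ := fun k hk hk7 =>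
    AffineNilp.Z₂_eq_bot hp3 hp h2 hp0 hk hk7
  have hφ : ∀ k : ℕ, 3 ≤ k → k < p + 2 → k ≠ 5 → k ≠ 7 →
      AffineNilp.IsBasisOf ![AffineNilp.φ F p k] (AffineNilp.Z₂ F p k) := by
    intro k hk hkp hk5 hk7
    refine AffineNilp.isBasisOf_φ h2 hk (by omega) hk5 hk7 fun h3 => ?_
    -- A weight divisible by 3 is nonzero in `F` here: `k = p` is excluded by `3 ∤ p`, and `p + 1`
    -- equals 1 in `F`.
    rcases (show k < p ∨ k = p ∨ k = p + 1 by omega) with h | rfl | rfl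
    · exact hcast k (by omega) h
    · omega
    · push_cast
      rw [hp0, zero_add]
      exact one_ne_zero
  have h5 := AffineNilp.isBasisOf_Z₂_five (F := F) hp
  refine ⟨hZ, hφ, h5, ?_, fun h => AffineNilp.isBasisOf_Z₂_seven (by omega),
    fun k hk hkp => AffineNilp.φ_eq_d₁ hk hkp, fun k hk5 hk7 hkp => ?_,
    AffineNilp.classIsBasis_of_pair h5 (AffineNilp.B₂_eq_span (by omega) hp), ?_,
    AffineNilp.classIsBasis_of_singleton (hφ (p + 1) (by omega) (by omega) (by omega) (by omega))
      (AffineNilp.B₂_eq_bot (by omega))⟩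
  · rintro rfl
    exact AffineNilp.isBasisOf_Z₂_seven_of_eq_five
  · apply AffineNilp.H₂_eq_bot_of_le
    rcases (show k < 3 ∨ (3 ≤ k ∧ k ≤ p) ∨ p + 2 ≤ k by omega) with h | ⟨h, h'⟩ | h
    · rw [AffineNilp.Z₂_eq_bot_of_lt_three h]
      exact bot_le
    · rw [← (hφ k h (by omega) hk5 hk7).2, AffineNilp.B₂_eq_span h h']
      simp
    · rw [hZ k h (by omega)]
      exact bot_le
  · rcases Nat.eq_or_lt_of_le hp with rfl | h
    · exact AffineNilp.classIsBasis_of_singleton AffineNilp.isBasisOf_Z₂_seven_of_eq_five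
        (AffineNilp.B₂_eq_bot (by omega))
    · exact AffineNilp.classIsBasis_of_pair (AffineNilp.isBasisOf_Z₂_seven (by omega))
        (AffineNilp.B₂_eq_span (by omega) (by omega))
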